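/- A composition of a positive integer $n$ is a finite sequence $(x_1,\dots,x_m)$ of positive integers with $x_1+\cdots+x_m=n$. For a composition, let $L$ denote the length of its longest run of consecutive equal parts, i.e. the largest $r$ such that $x_i=x_{i+1}=\cdots=x_{i+r-1}$ for some $i$. Let $\mathbb{P}_n$ be the uniform probability on the compositions of $n$, and let $\lg=\log_2$. Then the tails of the distribution of $L$ are small, in the following sense. (1) As $n\to\infty$, uniformly for integers $k<\tfrac34\lg n$, $$\mathbb{P}_n(L<k)=O\!\left(e^{-n^{1/4}/4}\right);$$ that is, there are constants $C$ and $N$ such that $\mathbb{P}_n(L<k)\le C\,e^{-n^{1/4}/4}$ for all $n\ge N$ and all integers $k<\tfrac34\lg n$. (2) As $n\to\infty$, uniformly for real $y>0$, $$\mathbb{P}_n(L\ge 2\lg n+y)=O\!\left(\frac{2^{-y}}{n}\right);$$ that is, there are constants $C$ and $N$ such that $\mathbb{P}_n(L\ge 2\lg n+y)\le C\,2^{-y}/n$ for all $n\ge N$ and all real $y>0$. -/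

import Mathlib

noncomputable section

namespace LongestRun

/-- The length of the longest run of consecutive equal entries of a list: the largest `m` such that
some value `a` occurs `m` times in a row as a contiguous block of `l`. -/
def longestRun (l : List ℕ) : ℕ :=
  sSup {m : ℕ | ∃ a : ℕ, List.replicate m a <:+: l}

/-- The supremum in `longestRun` is an attained maximum. -/
theorem isGreatest_longestRun (l : List ℕ) :
    IsGreatest {m : ℕ | ∃ a : ℕ, List.replicate m a <:+: l} (longestRun l) := by
  have hb : BddAbove {m : ℕ | ∃ a : ℕ, List.replicate m a <:+: l} := by
    refine ⟨l.length, ?_⟩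
    rintro m ⟨a, h⟩
    simpa using h.length_le
  have hne : {m : ℕ | ∃ a : ℕ, List.replicate m a <:+: l}.Nonempty :=
    ⟨0, 0, List.nil_infix⟩
  exact ⟨Nat.sSup_mem hne hb, fun m hm => le_csSup hb hm⟩

/-- The statistic `L`: the longest run of equal parts of a composition of `n`. -/
def L {n : ℕ} (c : Composition n) : ℕ := longestRun c.blocks

/-- The probability of the event `E` when all compositions of `n` are equally likely. -/
def prob (n : ℕ) (E : Set (Composition n)) : ℝ :=
  (E.ncard : ℝ) / (Fintype.card (Composition n) : ℝ)

end LongestRun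

end

/-! Both tails come from counting. For the lower tail, compositions of `n` are coded by bit strings
of length `n - 1`, where `k + 1` consecutive `true`s force `k` consecutive parts 1. So `L < k` costs
at most the number of strings avoiding such a block, and `ncard_avoiding_succ_add_le` makes the
density of these strings decay geometrically. This gives the bound `e * exp (-n / 2 ^ (k + 2))`, and
`2 ^ k ≤ n ^ (3/4)` finishes. For the upper tail, a union bound over the value and position of a run
of length `m` (`ncard_le_L_le`) leaves a geometric series of size `O(n / 2 ^ m)`; then `2 ^ m ≥ n ^
2 * 2 ^ y`. -/

namespace LongestRun

/-! ### Bit strings without a long block of `true` -/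

/-- The bit strings of length `N` without `r` consecutive `true`s. -/
def avoiding (r N : ℕ) : Set (List Bool) :=
  {l | l.length = N ∧ ¬ List.replicate r true <:+: l}

theorem finite_avoiding (r N : ℕ) : (avoiding r N).Finite :=
  (List.finite_length_eq Bool N).subset fun _ h => h.1

theorem ncard_length_eq (N : ℕ) : {l : List Bool | l.length = N}.ncard = 2 ^ N := by
  have h : Nat.card (List.Vector Bool N) = 2 ^ N := by
    simp [Nat.card_eq_fintype_card, card_vector]
  exact h

theorem ncard_avoiding_le_two_pow (r N : ℕ) : (avoiding r N).ncard ≤ 2 ^ N := by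
  rw [← ncard_length_eq N]
  exact Set.ncard_le_ncard (fun _ h => h.1) (List.finite_length_eq Bool N)

/-- A block of `true`s cannot cross the `false`, and the part before it is too short. -/
theorem replicate_true_infix_of_infix_append_false {r j : ℕ} (hj : j < r) {w : List Bool}
    (h : List.replicate r true <:+: List.replicate j true ++ false :: w) :
    List.replicate r true <:+: w := by
  induction j with
  | zero =>
    obtain ⟨s, rfl⟩ := Nat.exists_eq_succ_of_ne_zero (Nat.pos_iff_ne_zero.mp hj)
    rcases List.infix_cons_iff.mp h with h | h
    · simp [List.replicate_succ] at h
    · exact h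
  | succ j ih =>
    rw [List.replicate_succ, List.cons_append] at h
    rcases List.infix_cons_iff.mp h with h | h
    · have := (List.prefix_iff_getElem.mp h).2 (j + 1) (by simpa using hj)
      simp at this
    · exact ih (by omega) h

/-- The set of one-letter extensions of the strings in `avoiding r N`. -/
def extensions (r N : ℕ) : Set (List Bool) :=
  (fun p : Bool × List Bool => p.1 :: p.2) '' (Set.univ ×ˢ avoiding r N)

theorem finite_extensions (r N : ℕ) : (extensions r N).Finite :=
  (Set.finite_univ.prod (finite_avoiding r N)).image _

theorem ncard_extensions_le (r N : ℕ) : (extensions r N).ncard ≤ 2 * (avoiding r N).ncard := by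
  refine (Set.ncard_image_le (Set.finite_univ.prod (finite_avoiding r N))).trans ?_
  rw [Set.ncard_prod]
  simp

theorem avoiding_succ_subset_extensions (r N : ℕ) : avoiding r (N + 1) ⊆ extensions r N := by
  rintro (_ | ⟨b, l⟩) ⟨hl, h⟩
  · simp at hl
  · exact ⟨(b, l), ⟨trivial, by simpa using hl, fun h' => h (h'.trans (List.suffix_cons b l).isInfix)⟩,
      rfl⟩

theorem ncard_avoiding_succ_le (r N : ℕ) :
    (avoiding r (N + 1)).ncard ≤ 2 * (avoiding r N).ncard :=
  (Set.ncard_le_ncard (avoiding_succ_subset_extensions r N) (finite_extensions r N)).trans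
    (ncard_extensions_le r N)

theorem ncard_avoiding_add_le (r N j : ℕ) :
    (avoiding r (N + j)).ncard ≤ 2 ^ j * (avoiding r N).ncard := by
  induction j with
  | zero => simp
  | succ j ih =>
    calc (avoiding r (N + j + 1)).ncard ≤ 2 * (avoiding r (N + j)).ncard :=
          ncard_avoiding_succ_le r (N + j)
      _ ≤ 2 * (2 ^ j * (avoiding r N).ncard) := by gcongr
      _ = 2 ^ (j + 1) * (avoiding r N).ncard := by ring

/-- Among the one-letter extensions, the strings `true ^ r, false, w` with `w` avoiding are spoiled
by the new letter alone. -/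
theorem ncard_avoiding_succ_add_le {r : ℕ} (hr : 0 < r) (N : ℕ) :
    (avoiding r (N + r + 1)).ncard + (avoiding r N).ncard ≤ 2 * (avoiding r (N + r)).ncard := by
  obtain ⟨s, rfl⟩ := Nat.exists_eq_succ_of_ne_zero hr.ne'
  set g : List Bool → List Bool := fun w => List.replicate (s + 1) true ++ false :: w with hg
  have hinj : Function.Injective g := fun v w h => by simpa [hg] using h
  have hdisj : Disjoint (avoiding (s + 1) (N + (s + 1) + 1)) (g '' avoiding (s + 1) N) := by
    rw [Set.disjoint_left]
    rintro _ ⟨-, h⟩ ⟨w, -, rfl⟩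
    exact h (List.prefix_append _ _).isInfix
  have hsub : avoiding (s + 1) (N + (s + 1) + 1) ∪ g '' avoiding (s + 1) N ⊆
      extensions (s + 1) (N + (s + 1)) := by
    refine Set.union_subset (avoiding_succ_subset_extensions _ _) ?_
    rintro _ ⟨w, ⟨hw, h⟩, rfl⟩
    refine ⟨(true, List.replicate s true ++ false :: w), ⟨trivial, ?_, fun h' => ?_⟩, ?_⟩
    · simp [hw]; omega
    · exact h (replicate_true_infix_of_infix_append_false (Nat.lt_succ_self s) h')
    · simp [hg, List.replicate_succ]
  rw [← Set.ncard_image_of_injective (avoiding (s + 1) N) hinj,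
    ← Set.ncard_union_eq hdisj (finite_avoiding _ _) ((finite_avoiding _ _).image _)]
  exact (Set.ncard_le_ncard hsub (finite_extensions _ _)).trans (ncard_extensions_le _ _)

theorem ncard_avoiding_add_le_pow {r : ℕ} (hr : 0 < r) (j : ℕ) :
    ((avoiding r (r + j)).ncard : ℝ) ≤ 2 ^ (r + j) * (1 - 1 / 2 ^ (r + 1)) ^ j := by
  induction j with
  | zero =>
    simpa using (by exact_mod_cast ncard_avoiding_le_two_pow r r :
      ((avoiding r r).ncard : ℝ) ≤ 2 ^ r)
  | succ j ih =>
    have h1 : ((avoiding r (j + r + 1)).ncard : ℝ) + (avoiding r j).ncard ≤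
        2 * (avoiding r (j + r)).ncard := by exact_mod_cast ncard_avoiding_succ_add_le hr j
    have h2 : ((avoiding r (j + r)).ncard : ℝ) ≤ 2 ^ r * (avoiding r j).ncard := by
      exact_mod_cast ncard_avoiding_add_le r j r
    -- Turns the two-term recurrence into a one-step contraction by `1 - 1 / 2 ^ (r + 1)`, relative
    -- to doubling.
    have h3 : ((avoiding r (j + r)).ncard : ℝ) / 2 ^ r ≤ (avoiding r j).ncard := by
      rw [div_le_iff₀' (by positivity)]; exact h2
    have hq : (0 : ℝ) ≤ 1 - 1 / 2 ^ (r + 1) := by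
      rw [sub_nonneg, div_le_one (by positivity)]
      exact one_le_pow₀ (by norm_num)
    calc ((avoiding r (r + (j + 1))).ncard : ℝ) = (avoiding r (j + r + 1)).ncard := by
          rw [show r + (j + 1) = j + r + 1 by ring]
      _ ≤ 2 * (avoiding r (j + r)).ncard - (avoiding r (j + r)).ncard / 2 ^ r := by linarith
      _ = 2 * (1 - 1 / 2 ^ (r + 1)) * (avoiding r (r + j)).ncard := by
          rw [add_comm j r, pow_succ]; field_simp
      _ ≤ 2 * (1 - 1 / 2 ^ (r + 1)) * (2 ^ (r + j) * (1 - 1 / 2 ^ (r + 1)) ^ j) := by gcongr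
      _ = 2 ^ (r + (j + 1)) * (1 - 1 / 2 ^ (r + 1)) ^ (j + 1) := by ring

theorem ncard_avoiding_le_exp {r : ℕ} (hr : 0 < r) (N : ℕ) :
    ((avoiding r N).ncard : ℝ) ≤ 2 ^ N * Real.exp (-(((N : ℝ) - r) / 2 ^ (r + 1))) := by
  rcases le_total r N with h | h
  · obtain ⟨j, rfl⟩ := Nat.exists_eq_add_of_le h
    refine (ncard_avoiding_add_le_pow hr j).trans ?_
    have hq : (0 : ℝ) ≤ 1 - 1 / 2 ^ (r + 1) := by
      rw [sub_nonneg, div_le_one (by positivity)]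
      exact one_le_pow₀ (by norm_num)
    have hexp : Real.exp (-((((r + j : ℕ) : ℝ) - r) / 2 ^ (r + 1))) =
        Real.exp (-(1 / 2 ^ (r + 1))) ^ j := by
      rw [← Real.exp_nat_mul]; congr 1; push_cast; ring
    rw [hexp]
    gcongr
    exact Real.one_sub_le_exp_neg _
  · have h1 : ((avoiding r N).ncard : ℝ) ≤ 2 ^ N := by
      exact_mod_cast ncard_avoiding_le_two_pow r N
    refine h1.trans (le_mul_of_one_le_right (by positivity) (Real.one_le_exp ?_))
    rw [neg_nonneg]
    have : (N : ℝ) ≤ r := by exact_mod_cast h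
    exact div_nonpos_of_nonpos_of_nonneg (by linarith) (by positivity)

/-! ### Compositions as bit strings -/

/-- The composition of `N + 1` coded by a bit string of length `N`: the bit `true` opens a new part,
the bit `false` enlarges the first part of what follows. -/
def decode : List Bool → List ℕ
  | [] => [1]
  | true :: l => 1 :: decode l
  | false :: l => (decode l).modifyHead (· + 1)

/-- Surjectivity of the coding suffices, as only upper bounds on counts are needed. -/
theorem exists_decode_eq (N : ℕ) (l : List ℕ) (hpos : ∀ x ∈ l, 0 < x) (hsum : l.sum = N + 1) :
    ∃ b : List Bool, b.length = N ∧ decode b = l := by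
  induction N generalizing l with
  | zero =>
    refine ⟨[], rfl, ?_⟩
    rcases l with _ | ⟨x, _ | ⟨y, l⟩⟩
    · simp at hsum
    · simp at hsum; simp [decode, hsum]
    · simp at hpos hsum; omega
  | succ N ih =>
    rcases l with _ | ⟨x, l⟩
    · simp at hsum
    · simp only [List.mem_cons, forall_eq_or_imp, List.sum_cons] at hpos hsum
      rcases Nat.lt_or_ge 1 x with hx | hx
      · obtain ⟨b, hb, hd⟩ := ih ((x - 1) :: l)
          (by simp only [List.mem_cons, forall_eq_or_imp]; exact ⟨by omega, hpos.2⟩)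
          (by rw [List.sum_cons]; omega)
        refine ⟨false :: b, by simp [hb], ?_⟩
        simp [decode, hd]; omega
      · obtain ⟨b, hb, hd⟩ := ih l hpos.2 (by omega)
        refine ⟨true :: b, by simp [hb], ?_⟩
        simp [decode, hd]; omega

theorem decode_replicate_append (k : ℕ) (l : List Bool) :
    decode (List.replicate k true ++ l) = List.replicate k 1 ++ decode l := by
  induction k with
  | zero => simp
  | succ k ih => simp [List.replicate_succ, decode, ih]

/-- Bits placed in front can alter only the head of what is already decoded. -/
theorem infix_tail_decode_append {u : List ℕ} (p q : List Bool) (h : u <:+: (decode q).tail) :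
    u <:+: (decode (p ++ q)).tail := by
  induction p with
  | nil => exact h
  | cons b p ih =>
    cases b
    · have : (decode (false :: p ++ q)).tail = (decode (p ++ q)).tail := by
        simp only [List.cons_append, decode]
        cases decode (p ++ q) <;> rfl
      rwa [this]
    · exact ih.trans (List.tail_suffix _).isInfix

/-- One `true` is sacrificed: a preceding `false` may enlarge the first of the `k + 1` ones. -/
theorem replicate_one_infix_decode {k : ℕ} {b : List Bool}
    (h : List.replicate (k + 1) true <:+: b) : List.replicate k 1 <:+: decode b := by
  obtain ⟨p, s, rfl⟩ := h
  rw [List.append_assoc]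
  refine (infix_tail_decode_append p _ ?_).trans (List.tail_suffix _).isInfix
  rw [decode_replicate_append, List.replicate_succ, List.cons_append, List.tail_cons]
  exact (List.prefix_append _ _).isInfix

theorem ncard_L_lt_le (k N : ℕ) :
    {c : Composition (N + 1) | L c < k}.ncard ≤ (avoiding (k + 1) N).ncard := by
  rw [← Set.ncard_image_of_injective {c : Composition (N + 1) | L c < k}
    (f := Composition.blocks) (fun _ _ h => Composition.ext h)]
  refine (Set.ncard_le_ncard (t := decode '' avoiding (k + 1) N) ?_
    ((finite_avoiding _ _).image _)).trans (Set.ncard_image_le (finite_avoiding _ _))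
  rintro _ ⟨c, hc, rfl⟩
  obtain ⟨b, hb, hd⟩ := exists_decode_eq N c.blocks (fun _ h => c.blocks_pos h) c.blocks_sum
  refine ⟨b, ⟨hb, fun h => ?_⟩, hd⟩
  have h' := (isGreatest_longestRun c.blocks).2 ⟨1, hd ▸ replicate_one_infix_decode h⟩
  exact absurd hc (not_lt.mpr h')

theorem prob_L_lt_le (k N : ℕ) :
    prob (N + 1) {c | L c < k} ≤
      Real.exp 1 * Real.exp (-(((N + 1 : ℕ) : ℝ) / 2 ^ (k + 2))) := by
  rw [prob, composition_card, Nat.add_sub_cancel]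
  push_cast
  rw [div_le_iff₀' (by positivity)]
  have h1 : (({c : Composition (N + 1) | L c < k}.ncard : ℕ) : ℝ) ≤ (avoiding (k + 1) N).ncard := by
    exact_mod_cast ncard_L_lt_le k N
  refine h1.trans ((ncard_avoiding_le_exp k.succ_pos N).trans ?_)
  rw [← Real.exp_add]
  gcongr
  -- Replacing `N - (k + 1)` by `N + 1` in the exponent costs at most this 1, hence the factor `e`.
  have h2 : ((k : ℝ) + 2) / 2 ^ (k + 2) ≤ 1 := by
    rw [div_le_one (by positivity)]
    exact_mod_cast (Nat.lt_two_pow_self (n := k + 2)).le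
  have h3 : -(((N : ℝ) - (k + 1 : ℕ)) / 2 ^ (k + 1 + 1)) =
      ((k : ℝ) + 2) / 2 ^ (k + 2) + -(((N : ℝ) + 1) / 2 ^ (k + 2)) := by
    push_cast; ring
  rw [h3]
  linarith

/-! ### Compositions with a long run -/

theorem ncard_le_L_le {m : ℕ} (hm : 0 < m) (n : ℕ) :
    {c : Composition n | m ≤ L c}.ncard ≤
      ∑ a ∈ (Finset.Icc 1 n).filter (fun a => m * a ≤ n), (n + 1) * 2 ^ (n - m * a) := by
  classical
  set g : (a : ℕ) → ℕ × Composition (n - m * a) → List ℕ :=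
    fun a p => p.2.blocks.take p.1 ++ (List.replicate m a ++ p.2.blocks.drop p.1) with hg
  set T : Finset (List ℕ) := ((Finset.Icc 1 n).filter (fun a => m * a ≤ n)).biUnion
    (fun a => (Finset.range (n + 1) ×ˢ Finset.univ).image (g a)) with hT
  rw [← Set.ncard_image_of_injective {c : Composition n | m ≤ L c}
    (f := Composition.blocks) (fun _ _ h => Composition.ext h)]
  have hsub : Composition.blocks '' {c : Composition n | m ≤ L c} ⊆ (T : Set (List ℕ)) := by
    rintro _ ⟨c, hc, rfl⟩
    obtain ⟨a, ha⟩ := (isGreatest_longestRun c.blocks).1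
    have hpre : List.replicate m a <:+: List.replicate (longestRun c.blocks) a := by
      obtain ⟨d, hd⟩ := Nat.exists_eq_add_of_le (show m ≤ longestRun c.blocks from hc)
      rw [hd, List.replicate_add]
      exact (List.prefix_append _ _).isInfix
    obtain ⟨p, s, hps⟩ := hpre.trans ha
    have hsum : p.sum + m * a + s.sum = n := by
      have := c.blocks_sum
      rw [← hps] at this
      simpa [add_assoc] using this
    have hapos : 0 < a := c.blocks_pos (by rw [← hps]; simp [hm.ne'])
    have hlen : p.length ≤ n := by
      refine le_trans ?_ c.length_le
      rw [← Composition.blocks_length, ← hps]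
      simp
    have hle : m * a ≤ n := by omega
    rw [Finset.mem_coe, hT, Finset.mem_biUnion]
    refine ⟨a, ?_, ?_⟩
    · rw [Finset.mem_filter, Finset.mem_Icc]
      exact ⟨⟨hapos, (Nat.le_mul_of_pos_left a hm).trans hle⟩, hle⟩
    · rw [Finset.mem_image]
      -- Deleting the run leaves a composition of `n - m * a`, from which `c` is recovered by
      -- reinserting it.
      refine ⟨(p.length, ⟨p ++ s, ?_, ?_⟩), ?_, ?_⟩
      · intro i hi
        apply c.blocks_pos
        rw [← hps]
        simp only [List.mem_append] at hi ⊢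
        tauto
      · rw [List.sum_append]; omega
      · simpa using Nat.lt_succ_of_le hlen
      · simp [hg, ← hps]
  refine (Set.ncard_le_ncard hsub T.finite_toSet).trans ?_
  rw [Set.ncard_coe_finset]
  refine Finset.card_biUnion_le.trans (Finset.sum_le_sum fun a _ => ?_)
  refine Finset.card_image_le.trans ?_
  rw [Finset.card_product, Finset.card_range, Finset.card_univ, composition_card]
  -- Dropping the `- 1` in the exponent gives a bound that needs no separate case for an empty
  -- remainder.
  exact Nat.mul_le_mul_left _ (Nat.pow_le_pow_right two_pos (Nat.sub_le _ _))

theorem prob_le_L_le {m : ℕ} (hm : 0 < m) {n : ℕ} (hn : 0 < n) :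
    prob n {c | m ≤ L c} ≤ 8 * n / 2 ^ m := by
  have hx0 : (0 : ℝ) ≤ 1 / 2 ^ m := by positivity
  have hx : (1 : ℝ) / 2 ^ m ≤ 1 / 2 := by
    gcongr
    exact le_self_pow₀ (by norm_num) hm.ne'
  have hgeom : ∑ a ∈ Finset.Icc 1 n, ((1 : ℝ) / 2 ^ m) ^ a ≤ 2 * (1 / 2 ^ m) := by
    have h := geom_sum_Ico_le_of_lt_one (m := 1) (n := n + 1) hx0 (by linarith)
    rw [← Finset.Ico_add_one_right_eq_Icc]
    refine h.trans ?_
    rw [pow_one, div_le_iff₀ (by linarith)]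
    nlinarith
  have hcount : (({c : Composition n | m ≤ L c}.ncard : ℕ) : ℝ) ≤
      (n + 1) * 2 ^ n * (2 * (1 / 2 ^ m)) := by
    have h1 : (({c : Composition n | m ≤ L c}.ncard : ℕ) : ℝ) ≤
        ∑ a ∈ (Finset.Icc 1 n).filter (fun a => m * a ≤ n),
          ((n : ℝ) + 1) * 2 ^ (n - m * a) := by
      exact_mod_cast ncard_le_L_le hm n
    calc (({c : Composition n | m ≤ L c}.ncard : ℕ) : ℝ)
        ≤ ∑ a ∈ (Finset.Icc 1 n).filter (fun a => m * a ≤ n),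
          ((n : ℝ) + 1) * 2 ^ (n - m * a) := h1
      _ = ∑ a ∈ (Finset.Icc 1 n).filter (fun a => m * a ≤ n),
          ((n : ℝ) + 1) * 2 ^ n * (1 / 2 ^ m) ^ a := by
          refine Finset.sum_congr rfl fun a ha => ?_
          rw [pow_sub₀ _ two_ne_zero (Finset.mem_filter.mp ha).2, pow_mul, one_div, inv_pow]
          ring
      _ ≤ ∑ a ∈ Finset.Icc 1 n, ((n : ℝ) + 1) * 2 ^ n * (1 / 2 ^ m) ^ a :=
          Finset.sum_le_sum_of_subset_of_nonneg (Finset.filter_subset _ _)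
            fun _ _ _ => by positivity
      _ ≤ (n + 1) * 2 ^ n * (2 * (1 / 2 ^ m)) := by
          rw [← Finset.mul_sum]; gcongr
  have hn1 : (1 : ℝ) ≤ n := by exact_mod_cast hn
  have hpow : (2 : ℝ) ^ n = 2 * 2 ^ (n - 1) := by
    rw [← pow_succ', Nat.sub_add_cancel hn]
  rw [prob, composition_card]
  push_cast
  rw [div_le_iff₀ (by positivity)]
  refine hcount.trans ?_
  calc ((n : ℝ) + 1) * 2 ^ n * (2 * (1 / 2 ^ m))
      ≤ (n + n) * 2 ^ n * (2 * (1 / 2 ^ m)) := by gcongr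
    _ = 8 * n / 2 ^ m * 2 ^ (n - 1) := by rw [hpow]; ring

theorem prob_mono {n : ℕ} {E F : Set (Composition n)} (h : E ⊆ F) : prob n E ≤ prob n F := by
  unfold prob
  gcongr
  exact F.toFinite

end LongestRun

theorem mainTheorem8 :
    (∃ C : ℝ, ∀ᶠ n : ℕ in Filter.atTop, ∀ k : ℤ, (k : ℝ) < 3 / 4 * Real.logb 2 (n : ℝ) →
      LongestRun.prob n {c | (LongestRun.L c : ℤ) < k} ≤
        C * Real.exp (-((n : ℝ) ^ (1 / 4 : ℝ) / 4))) ∧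
    (∃ C : ℝ, ∀ᶠ n : ℕ in Filter.atTop, ∀ y : ℝ, 0 < y →
      LongestRun.prob n {c | 2 * Real.logb 2 (n : ℝ) + y ≤ (LongestRun.L c : ℝ)} ≤
        C * ((2 : ℝ) ^ (-y) / (n : ℝ))) := by
  constructor
  · refine ⟨Real.exp 1, ?_⟩
    filter_upwards [Filter.eventually_ge_atTop 1] with n hn k hk
    have hn0 : (0 : ℝ) < n := by exact_mod_cast hn
    rcases lt_or_ge k 0 with hk0 | hk0
    · have hempty : {c : Composition n | (LongestRun.L c : ℤ) < k} = ∅ := by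
        ext c; simp; omega
      rw [hempty, LongestRun.prob, Set.ncard_empty]
      simp only [Nat.cast_zero, zero_div]
      positivity
    · lift k to ℕ using hk0
      obtain ⟨N, rfl⟩ := Nat.exists_eq_add_of_le' hn
      simp only [Nat.cast_lt, Int.cast_natCast] at hk ⊢
      refine (LongestRun.prob_L_lt_le k N).trans ?_
      refine mul_le_mul_of_nonneg_left (Real.exp_le_exp.mpr (neg_le_neg ?_)) (Real.exp_pos 1).le
      set x : ℝ := ((N + 1 : ℕ) : ℝ) with hx
      have hpow : (2 : ℝ) ^ k ≤ x ^ (3 / 4 : ℝ) := by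
        rw [← Real.rpow_natCast]
        calc (2 : ℝ) ^ (k : ℝ) ≤ 2 ^ (3 / 4 * Real.logb 2 x) :=
              Real.rpow_le_rpow_of_exponent_le (by norm_num) hk.le
          _ = x ^ (3 / 4 : ℝ) := by
              rw [mul_comm, Real.rpow_mul (by norm_num),
                Real.rpow_logb (by norm_num) (by norm_num) hn0]
      have hsplit : x ^ (1 / 4 : ℝ) * x ^ (3 / 4 : ℝ) = x := by
        rw [← Real.rpow_add hn0]; norm_num
      rw [div_le_div_iff₀ (by norm_num) (by positivity)]
      calc x ^ (1 / 4 : ℝ) * 2 ^ (k + 2) = x ^ (1 / 4 : ℝ) * 2 ^ k * 4 := by ring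
        _ ≤ x ^ (1 / 4 : ℝ) * x ^ (3 / 4 : ℝ) * 4 := by gcongr
        _ = x * 4 := by rw [hsplit]
  · refine ⟨8, ?_⟩
    filter_upwards [Filter.eventually_ge_atTop 1] with n hn y hy
    have hn0 : (0 : ℝ) < n := by exact_mod_cast hn
    have hlog : 0 ≤ Real.logb 2 (n : ℝ) :=
      Real.logb_nonneg (by norm_num) (by exact_mod_cast hn)
    set m : ℕ := ⌈2 * Real.logb 2 (n : ℝ) + y⌉₊ with hm
    have hm0 : 0 < m := Nat.ceil_pos.mpr (by linarith)
    have hpow : (n : ℝ) ^ 2 * 2 ^ y ≤ 2 ^ m := by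
      rw [← Real.rpow_natCast 2 m]
      calc (n : ℝ) ^ 2 * 2 ^ y = 2 ^ (2 * Real.logb 2 (n : ℝ) + y) := by
            rw [Real.rpow_add (by norm_num), mul_comm 2, Real.rpow_mul (by norm_num),
              Real.rpow_logb (by norm_num) (by norm_num) hn0, Real.rpow_two]
        _ ≤ 2 ^ (m : ℝ) := Real.rpow_le_rpow_of_exponent_le (by norm_num) (Nat.le_ceil _)
    have hsub : {c : Composition n | 2 * Real.logb 2 (n : ℝ) + y ≤ (LongestRun.L c : ℝ)} ⊆
        {c | m ≤ LongestRun.L c} := fun c hc => Nat.ceil_le.mpr hc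
    refine (LongestRun.prob_mono hsub).trans ((LongestRun.prob_le_L_le hm0 hn).trans ?_)
    calc 8 * (n : ℝ) / 2 ^ m ≤ 8 * n / ((n : ℝ) ^ 2 * 2 ^ y) := by gcongr
      _ = 8 * ((2 : ℝ) ^ (-y) / n) := by
          rw [Real.rpow_neg (by norm_num)]; field_simp
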